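/- Graphs are finite, simple and undirected. A fractional perfect matching of a graph $G$ is a function $f:E(G)\to[0,1]$ such that $\sum_{e\ni v}f(e)=1$ for every vertex $v$. The fractional matching preclusion number $\mathrm{fmp}(G)$ is the minimum size of a set $F\subseteq E(G)$ such that $G-F$ has no fractional perfect matching. For integers $n,k$ let $s(n,k)$ be the minimum of $|E(G)|$ over all graphs $G$ with $n$ vertices and $\mathrm{fmp}(G)=k$. **Theorem.** For every odd integer $n\ge 9$, there are graphs with $n$ vertices and fractional matching preclusion number $2$, and $$s(n,2)=n+3.$$ -/

import Mathlib

/-- `f` assigns to each edge of `G` a number in `[0,1]` such that the values on the edges incident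
with any vertex add up to at most `1`.  Only the values of `f` on edges of `G` matter. -/
def IsFractionalMatching {V : Type*} [Fintype V] (G : SimpleGraph V) (f : Sym2 V → ℝ) : Prop :=
  (∀ e ∈ G.edgeSet, 0 ≤ f e ∧ f e ≤ 1) ∧
    ∀ v : V, ∑ e ∈ (Set.toFinite (G.incidenceSet v)).toFinset, f e ≤ 1

/-- A fractional matching whose values on the edges incident with any vertex add up to `1`. -/
def IsFractionalPerfectMatching {V : Type*} [Fintype V] (G : SimpleGraph V) (f : Sym2 V → ℝ) :
    Prop :=
  IsFractionalMatching G f ∧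
    ∀ v : V, ∑ e ∈ (Set.toFinite (G.incidenceSet v)).toFinset, f e = 1

/-- A set `F` of edges of `G` such that `G - F` has no fractional perfect matching. -/
def IsFMPSet {V : Type*} [Fintype V] (G : SimpleGraph V) (F : Finset (Sym2 V)) : Prop :=
  (F : Set (Sym2 V)) ⊆ G.edgeSet ∧
    ¬ ∃ f : Sym2 V → ℝ, IsFractionalPerfectMatching (G.deleteEdges (F : Set (Sym2 V))) f

/-- The minimum size of an FMP set of `G`.  If `V` is non-empty then the set of all edges
is an FMP set, so that the minimum exists. -/
noncomputable def fmp {V : Type*} [Fintype V] (G : SimpleGraph V) : ℕ :=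
  sInf {k : ℕ | ∃ F : Finset (Sym2 V), IsFMPSet G F ∧ F.card = k}

/-- The graphs of order `n` with fractional matching preclusion number `k`. -/
def graphsWithFmp (n k : ℕ) : Set (SimpleGraph (Fin n)) :=
  {G | fmp G = k}

/-- The minimum number of edges of a graph of order `n` with fractional matching preclusion
number `k`.  (The infimum of the empty set is `0`, so a positive value is attained.) -/
noncomputable def minEdges (n k : ℕ) : ℕ :=
  sInf {m : ℕ | ∃ G ∈ graphsWithFmp n k, G.edgeSet.ncard = m}

open scoped Classical in
/-- The sum over the edges at a vertex as a sum over all vertices. -/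
theorem sum_incidenceSet_eq {V : Type*} [Fintype V] (G : SimpleGraph V) (f : Sym2 V → ℝ) (v : V) :
    ∑ e ∈ (Set.toFinite (G.incidenceSet v)).toFinset, f e =
      ∑ u, if G.Adj v u then f s(v, u) else 0 := by
  rw [← Finset.sum_filter]
  symm
  refine Finset.sum_bij (fun u _ => s(v, u)) ?_ ?_ ?_ ?_
  · intro u hu
    simpa [SimpleGraph.incidenceSet] using hu
  · intro a _ b _ h
    exact Sym2.congr_right.1 h
  · intro e he
    simp only [Set.Finite.mem_toFinset] at he
    obtain ⟨u, rfl⟩ := Sym2.mem_iff_exists.1 he.2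
    exact ⟨u, by simpa using he.1, rfl⟩
  · intros; rfl

/-- A fractional perfect matching, as a symmetric non-negative matrix supported on the edges and
with row sums `1`. -/
structure IsMatchingWeight {V : Type*} [Fintype V] (G : SimpleGraph V) (w : V → V → ℝ) : Prop where
  symm : ∀ u v, w u v = w v u
  nonneg : ∀ u v, 0 ≤ w u v
  supp : ∀ u v, ¬ G.Adj u v → w u v = 0
  sum_eq : ∀ u, ∑ v, w u v = 1

open scoped Classical in
theorem IsFractionalPerfectMatching.isMatchingWeight {V : Type*} [Fintype V] {G : SimpleGraph V}
    {f : Sym2 V → ℝ} (hf : IsFractionalPerfectMatching G f) :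
    IsMatchingWeight G (fun u v => if G.Adj u v then f s(u, v) else 0) where
  symm u v := by simp only [G.adj_comm u v, Sym2.eq_swap (a := u)]
  nonneg u v := by
    split_ifs with h
    · exact (hf.1.1 s(u, v) h).1
    · exact le_rfl
  supp u v h := if_neg h
  sum_eq u := by rw [← sum_incidenceSet_eq]; exact hf.2 u

namespace IsMatchingWeight

variable {V : Type*} [Fintype V] {G : SimpleGraph V} {w : V → V → ℝ}

theorem le_one (hw : IsMatchingWeight G w) (u v : V) : w u v ≤ 1 := by
  rw [← hw.sum_eq u]
  exact Finset.single_le_sum (f := w u) (fun i _ => hw.nonneg u i) (Finset.mem_univ v)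

theorem add_le_one (hw : IsMatchingWeight G w) {u v v' : V} (h : v ≠ v') :
    w u v + w u v' ≤ 1 := by
  classical
  rw [← hw.sum_eq u, ← Finset.sum_pair (f := w u) h]
  exact Finset.sum_le_sum_of_subset_of_nonneg (Finset.subset_univ _) (fun i _ _ => hw.nonneg u i)

theorem mono {G' : SimpleGraph V} (h : G ≤ G') (hw : IsMatchingWeight G w) :
    IsMatchingWeight G' w :=
  ⟨hw.symm, hw.nonneg, fun u v huv => hw.supp u v fun h' => huv (h h'), hw.sum_eq⟩

theorem isFractionalPerfectMatching (hw : IsMatchingWeight G w) :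
    IsFractionalPerfectMatching G (Sym2.lift ⟨w, hw.symm⟩) := by
  classical
  have h1 : ∀ v : V, ∑ e ∈ (Set.toFinite (G.incidenceSet v)).toFinset,
      Sym2.lift ⟨w, hw.symm⟩ e = 1 := by
    intro v
    rw [sum_incidenceSet_eq, ← hw.sum_eq v]
    refine Finset.sum_congr rfl fun u _ => ?_
    split_ifs with h
    · rfl
    · exact (hw.supp v u h).symm
  refine ⟨⟨fun e _ => ?_, fun v => (h1 v).le⟩, h1⟩
  induction e with
  | h u v => exact ⟨hw.nonneg u v, hw.le_one u v⟩

end IsMatchingWeight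

/-- Every edge is avoided by a fractional perfect matching. -/
structure IsRobust {V : Type*} [Fintype V] (G : SimpleGraph V) : Prop where
  exists_weight : ∃ w, IsMatchingWeight G w
  avoid : ∀ a b, G.Adj a b → ∃ w, IsMatchingWeight G w ∧ w a b = 0

theorem isRobust_of_two_le_fmp {V : Type*} [Fintype V] {G : SimpleGraph V} (h : 2 ≤ fmp G) :
    IsRobust G := by
  have key : ∀ F : Finset (Sym2 V), (F : Set (Sym2 V)) ⊆ G.edgeSet → F.card < 2 →
      ∃ w, IsMatchingWeight (G.deleteEdges (F : Set (Sym2 V))) w := by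
    intro F hF hc
    by_contra hne
    have : fmp G ≤ F.card := Nat.sInf_le ⟨F, ⟨hF, fun ⟨f, hf⟩ => hne ⟨_, hf.isMatchingWeight⟩⟩, rfl⟩
    omega
  refine ⟨?_, fun a b hab => ?_⟩
  · obtain ⟨w, hw⟩ := key ∅ (by simp) (by simp)
    exact ⟨w, hw.mono (SimpleGraph.deleteEdges_le _)⟩
  · obtain ⟨w, hw⟩ := key {s(a, b)} (by simpa using hab) (by simp)
    exact ⟨w, hw.mono (SimpleGraph.deleteEdges_le _), hw.supp a b (by simp)⟩

namespace IsRobust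

open scoped Classical

variable {V : Type*} [Fintype V] {G : SimpleGraph V}

theorem two_le_degree (hG : IsRobust G) (v : V) : 2 ≤ G.degree v := by
  obtain ⟨w, hw⟩ := hG.exists_weight
  obtain ⟨a, -, ha⟩ : ∃ a ∈ Finset.univ, w v a ≠ 0 :=
    Finset.exists_ne_zero_of_sum_ne_zero (by rw [hw.sum_eq v]; exact one_ne_zero)
  have hva : G.Adj v a := by
    by_contra h
    exact ha (hw.supp v a h)
  obtain ⟨w', hw', h0⟩ := hG.avoid v a hva
  obtain ⟨b, -, hb⟩ : ∃ b ∈ Finset.univ, w' v b ≠ 0 :=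
    Finset.exists_ne_zero_of_sum_ne_zero (by rw [hw'.sum_eq v]; exact one_ne_zero)
  have hvb : G.Adj v b := by
    by_contra h
    exact hb (hw'.supp v b h)
  have hab : a ≠ b := by
    rintro rfl
    exact hb h0
  rw [← SimpleGraph.card_neighborFinset_eq_degree, ← Finset.card_pair hab]
  exact Finset.card_le_card (by simp [Finset.insert_subset_iff, hva, hvb])

/-- An edge at a vertex of degree two has weight one in some fractional perfect matching. -/
theorem exists_weight_eq_one (hG : IsRobust G) {u v : V} (huv : G.Adj u v) (hu : G.degree u = 2) :
    ∃ w, IsMatchingWeight G w ∧ w u v = 1 := by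
  obtain ⟨a, b, hab, hN⟩ := Finset.card_eq_two.1 hu
  obtain ⟨t, htv, hN⟩ : ∃ t, t ≠ v ∧ ∀ y, G.Adj u y ↔ y = t ∨ y = v := by
    have h : ∀ y, G.Adj u y ↔ y = a ∨ y = b := fun y => by
      rw [← SimpleGraph.mem_neighborFinset, hN]; simp
    rcases (h v).1 huv with rfl | rfl
    · exact ⟨b, hab.symm, fun y => by rw [h, or_comm]⟩
    · exact ⟨a, hab, h⟩
  obtain ⟨w, hw, h0⟩ := hG.avoid u t ((hN t).2 (Or.inl rfl))
  refine ⟨w, hw, ?_⟩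
  rw [← hw.sum_eq u]
  symm
  refine Finset.sum_eq_single v (fun y _ hy => ?_) (by simp)
  by_cases hyt : y = t
  · rw [hyt, h0]
  · exact hw.supp u y fun h => ((hN y).1 h).elim hyt hy

end IsRobust

/-- If a symmetric matrix vanishes inside `Z` except between entries of opposite signs, then only
the entries leaving `Z` contribute to the signed sum of its rows. -/
theorem sum_signed_rows {V : Type*} [Fintype V] [DecidableEq V] (Z : Finset V) (s : V → ℝ)
    (w : V → V → ℝ) (hw : ∀ u v, w u v = w v u)
    (hs : ∀ u ∈ Z, ∀ v ∈ Z, w u v ≠ 0 → s u + s v = 0) :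
    ∑ u ∈ Z, s u * ∑ v, w u v = ∑ u ∈ Z, ∑ v ∈ Zᶜ, s u * w u v := by
  have h0 : ∑ u ∈ Z, ∑ v ∈ Z, s u * w u v = 0 := by
    have h1 : ∑ u ∈ Z, ∑ v ∈ Z, s u * w u v = ∑ u ∈ Z, ∑ v ∈ Z, s v * w u v := by
      rw [Finset.sum_comm]
      exact Finset.sum_congr rfl fun u _ => Finset.sum_congr rfl fun v _ => by rw [hw]
    have h2 : ∑ u ∈ Z, ∑ v ∈ Z, s u * w u v + ∑ u ∈ Z, ∑ v ∈ Z, s v * w u v = 0 := by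
      rw [← Finset.sum_add_distrib]
      refine Finset.sum_eq_zero fun u hu => ?_
      rw [← Finset.sum_add_distrib]
      refine Finset.sum_eq_zero fun v hv => ?_
      by_cases h : w u v = 0
      · simp [h]
      · rw [← add_mul, hs u hu v hv h, zero_mul]
    linarith
  have h3 : ∀ u ∈ Z, s u * ∑ v, w u v = ∑ v ∈ Z, s u * w u v + ∑ v ∈ Zᶜ, s u * w u v := by
    intro u _
    rw [Finset.sum_add_sum_compl, Finset.mul_sum]
  rw [Finset.sum_congr rfl h3, Finset.sum_add_distrib, h0, zero_add]

section Colouring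

open scoped Classical

variable {V : Type*}

/-- The edges joining vertices of different colours. -/
def cutGraph (G : SimpleGraph V) (c : V → Bool) : SimpleGraph V where
  Adj u v := G.Adj u v ∧ c u ≠ c v
  symm := ⟨fun _ _ h => ⟨h.1.symm, h.2.symm⟩⟩
  loopless := ⟨fun _ h => h.2 rfl⟩

/-- The edges joining vertices of the same colour. -/
def monoGraph (G : SimpleGraph V) (c : V → Bool) : SimpleGraph V where
  Adj u v := G.Adj u v ∧ c u = c v
  symm := ⟨fun _ _ h => ⟨h.1.symm, h.2.symm⟩⟩
  loopless := ⟨fun _ h => h.1.ne rfl⟩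

theorem cutGraph_adj {G : SimpleGraph V} {c : V → Bool} {u v : V} :
    (cutGraph G c).Adj u v ↔ G.Adj u v ∧ c u ≠ c v := Iff.rfl

theorem monoGraph_adj {G : SimpleGraph V} {c : V → Bool} {u v : V} :
    (monoGraph G c).Adj u v ↔ G.Adj u v ∧ c u = c v := Iff.rfl

theorem cut_or_mono {G : SimpleGraph V} {c : V → Bool} {a b : V} (h : G.Adj a b) :
    (cutGraph G c).Adj a b ∨ (monoGraph G c).Adj a b := by
  by_cases hc : c a = c b
  · exact Or.inr ⟨h, hc⟩
  · exact Or.inl ⟨h, hc⟩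

/-- The sign of a colour. -/
def colourSign : Bool → ℝ
  | true => 1
  | false => -1

theorem colourSign_add_eq_zero {a b : Bool} (h : a ≠ b) : colourSign a + colourSign b = 0 := by
  cases a <;> cases b <;> simp_all [colourSign]

theorem colourSign_ne_zero (a : Bool) : colourSign a ≠ 0 := by
  cases a <;> simp [colourSign]

variable [Fintype V]

theorem degree_cut_add_mono (G : SimpleGraph V) (c : V → Bool) (v : V) :
    (cutGraph G c).degree v + (monoGraph G c).degree v = G.degree v := by
  simp only [← SimpleGraph.card_neighborFinset_eq_degree]
  rw [← Finset.card_union_of_disjoint]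
  · congr 1
    ext u
    simp only [Finset.mem_union, SimpleGraph.mem_neighborFinset, cutGraph_adj, monoGraph_adj]
    tauto
  · rw [Finset.disjoint_left]
    intro u hu hu'
    simp only [SimpleGraph.mem_neighborFinset, cutGraph_adj, monoGraph_adj] at hu hu'
    exact hu.2 hu'.2

/-- The pairs `(u, v)` of adjacent vertices with `u ∈ Z` and `v ∉ Z`. -/
noncomputable def crossing (H : SimpleGraph V) (Z : Finset V) : Finset (V × V) :=
  (Z ×ˢ Zᶜ).filter fun p => H.Adj p.1 p.2

theorem mem_crossing {H : SimpleGraph V} {Z : Finset V} {p : V × V} :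
    p ∈ crossing H Z ↔ p.1 ∈ Z ∧ p.2 ∉ Z ∧ H.Adj p.1 p.2 := by
  simp [crossing, and_assoc]

theorem card_crossing_singleton (H : SimpleGraph V) (v : V) :
    (crossing H {v}).card = H.degree v := by
  rw [← SimpleGraph.card_neighborFinset_eq_degree]
  symm
  refine Finset.card_bij (fun u _ => (v, u)) ?_ ?_ ?_
  · intro u hu
    rw [SimpleGraph.mem_neighborFinset] at hu
    simpa [mem_crossing, hu] using hu.ne'
  · intro a _ b _ h
    simpa using h
  · rintro ⟨a, b⟩ h
    simp only [mem_crossing, Finset.mem_singleton] at h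
    obtain ⟨rfl, -, h⟩ := h
    exact ⟨b, by simpa using h, rfl⟩

/-- A colouring with the largest number of edges joining different colours. -/
def IsMaxCut (G : SimpleGraph V) (c : V → Bool) : Prop :=
  ∀ c' : V → Bool, ∑ v, (cutGraph G c').degree v ≤ ∑ v, (cutGraph G c).degree v

theorem exists_isMaxCut (G : SimpleGraph V) : ∃ c, IsMaxCut G c :=
  Finite.exists_max fun c : V → Bool => ∑ v, (cutGraph G c).degree v

theorem sum_degree_eq_card_crossing (H : SimpleGraph V) (Z : Finset V) :
    ∑ v, H.degree v = (∑ v, ((H.neighborFinset v).filter fun u => (u ∈ Z ↔ v ∈ Z)).card) +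
      2 * (crossing H Z).card := by
  have h1 : ∀ v, H.degree v = ((H.neighborFinset v).filter fun u => (u ∈ Z ↔ v ∈ Z)).card +
      ((H.neighborFinset v).filter fun u => ¬ (u ∈ Z ↔ v ∈ Z)).card := by
    intro v
    rw [Finset.card_filter_add_card_filter_not, SimpleGraph.card_neighborFinset_eq_degree]
  rw [Finset.sum_congr rfl fun v _ => h1 v, Finset.sum_add_distrib]
  congr 1
  have h2 : ∑ v, ((H.neighborFinset v).filter fun u => ¬ (u ∈ Z ↔ v ∈ Z)).card =
      (crossing H Z ∪ (crossing H Z).map (Equiv.prodComm V V).toEmbedding).card := by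
    rw [← Finset.card_sigma]
    refine Finset.card_bij (fun p _ => (p.1, p.2)) ?_ ?_ ?_
    · rintro ⟨v, u⟩ h
      simp only [Finset.mem_sigma, Finset.mem_univ, Finset.mem_filter,
        SimpleGraph.mem_neighborFinset, true_and] at h
      simp only [Finset.mem_union, mem_crossing, Finset.mem_map_equiv, Equiv.prodComm_symm,
        Equiv.prodComm_apply, Prod.fst_swap, Prod.snd_swap, H.adj_comm u v]
      tauto
    · rintro ⟨v, u⟩ _ ⟨v', u'⟩ _ h
      simpa using h
    · rintro ⟨v, u⟩ h
      simp only [Finset.mem_union, mem_crossing, Finset.mem_map_equiv, Equiv.prodComm_symm,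
        Equiv.prodComm_apply, Prod.fst_swap, Prod.snd_swap, H.adj_comm u v] at h
      refine ⟨⟨v, u⟩, ?_, rfl⟩
      simp only [Finset.mem_sigma, Finset.mem_univ, Finset.mem_filter,
        SimpleGraph.mem_neighborFinset, true_and]
      tauto
  rw [h2, Finset.card_union_of_disjoint, Finset.card_map, two_mul]
  rw [Finset.disjoint_left]
  rintro ⟨v, u⟩ h h'
  simp only [mem_crossing, Finset.mem_map_equiv, Equiv.prodComm_symm,
        Equiv.prodComm_apply, Prod.fst_swap, Prod.snd_swap] at h h'
  exact h.2.1 h'.1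

/-- Switching the colours of the vertices in `Z`. -/
noncomputable def switch (c : V → Bool) (Z : Finset V) (v : V) : Bool := if v ∈ Z then !c v else c v

theorem IsMaxCut.card_crossing_le {G : SimpleGraph V} {c : V → Bool} (hc : IsMaxCut G c)
    (Z : Finset V) : (crossing (monoGraph G c) Z).card ≤ (crossing (cutGraph G c) Z).card := by
  have h := hc (switch c Z)
  rw [sum_degree_eq_card_crossing _ Z, sum_degree_eq_card_crossing _ Z] at h
  have h1 : crossing (cutGraph G (switch c Z)) Z = crossing (monoGraph G c) Z := by
    ext ⟨u, v⟩
    simp only [mem_crossing]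
    refine and_congr_right fun hu => and_congr_right fun hv => ?_
    simp only [cutGraph_adj, monoGraph_adj, switch, if_pos hu, if_neg hv]
    cases c u <;> cases c v <;> simp
  have h2 : ∀ v, ((cutGraph G (switch c Z)).neighborFinset v).filter (fun u => (u ∈ Z ↔ v ∈ Z)) =
      ((cutGraph G c).neighborFinset v).filter (fun u => (u ∈ Z ↔ v ∈ Z)) := by
    intro v
    ext u
    simp only [Finset.mem_filter, SimpleGraph.mem_neighborFinset]
    refine and_congr_left fun huv => ?_
    by_cases hv : v ∈ Z
    · simp [cutGraph_adj, switch, hv, huv.2 hv]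
    · simp [cutGraph_adj, switch, hv, huv]
  rw [h1] at h
  simp only [h2] at h
  omega

theorem IsMaxCut.degree_mono_le {G : SimpleGraph V} {c : V → Bool} (hc : IsMaxCut G c) (v : V) :
    (monoGraph G c).degree v ≤ (cutGraph G c).degree v := by
  simpa only [card_crossing_singleton] using hc.card_crossing_le {v}

end Colouring

section Tails

open scoped Classical

variable {V : Type*} [Fintype V] {G : SimpleGraph V} {c : V → Bool}

theorem sum_adj_eq_degree (H : SimpleGraph V) (v : V) :
    ∑ u, (if H.Adj v u then (1 : ℝ) else 0) = H.degree v := by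
  rw [Finset.sum_boole, ← SimpleGraph.card_neighborFinset_eq_degree]
  congr 2
  ext u
  simp

/-- In a robust graph no odd cycle has all but one of its vertices of degree two. -/
theorem IsRobust.not_odd_loop (hG : IsRobust G) {Z : Finset V} {x y u : V}
    (h2 : ∀ v ∈ Z, G.degree v = 2) (hx : x ∈ Z) (hy : y ∈ Z) (hu : u ∉ Z) (hxu : G.Adj x u)
    (hyu : G.Adj y u) (hcx : c x ≠ c u) (hcy : c y = c u)
    (hin : ∀ v ∈ Z, ∀ t ∈ Z, G.Adj v t → c v ≠ c t)
    (hout : ∀ v ∈ Z, ∀ t ∉ Z, G.Adj v t → t = u ∧ (v = x ∨ v = y)) : False := by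
  have hxy : x ≠ y := by
    rintro rfl
    exact hcx hcy
  have key : ∀ w : V → V → ℝ, (∀ a b, w a b = w b a) → (∀ a b, ¬ G.Adj a b → w a b = 0) →
      ∑ v ∈ Z, colourSign (c v) * ∑ t, w v t =
        colourSign (c x) * w x u + colourSign (c y) * w y u := by
    intro w hsymm hsupp
    rw [sum_signed_rows Z _ w hsymm]
    · have h1 : ∀ v ∈ Z, ∑ t ∈ Zᶜ, colourSign (c v) * w v t = colourSign (c v) * w v u := by
        intro v hv
        refine Finset.sum_eq_single u (fun t ht htu => ?_) (fun h => absurd hu (by simpa using h))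
        rw [hsupp v t, mul_zero]
        exact fun h => htu (hout v hv t (by simpa using ht) h).1
      rw [Finset.sum_congr rfl h1, ← Finset.sum_pair (f := fun v => colourSign (c v) * w v u) hxy]
      symm
      refine Finset.sum_subset (by simp [Finset.insert_subset_iff, hx, hy]) fun v hv hv' => ?_
      rw [hsupp v u, mul_zero]
      intro h
      exact hv' (by simpa using (hout v hv u hu h).2)
    · intro v hv t ht h
      refine colourSign_add_eq_zero (hin v hv t ht ?_)
      by_contra h'
      exact h (hsupp v t h')
  have hs : colourSign (c y) = - colourSign (c x) := by
    have := colourSign_add_eq_zero (fun h => hcx (h.trans hcy) : c x ≠ c y)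
    linarith
  obtain ⟨w, hw, hw1⟩ := hG.exists_weight_eq_one hxu (h2 x hx)
  have e1 := key w hw.symm hw.supp
  have e2 := key (fun a b => if G.Adj a b then 1 else 0) (fun a b => by simp only [G.adj_comm a b])
    (fun a b h => if_neg h)
  simp only [sum_adj_eq_degree, if_pos hxu, if_pos hyu] at e2
  rw [Finset.sum_congr rfl fun v hv => by rw [h2 v hv], ← Finset.sum_mul, hs] at e2
  simp only [hw.sum_eq] at e1
  rw [← Finset.sum_mul, hs, hw1] at e1
  push_cast at e2
  have e3 : colourSign (c x) * (1 - w y u) = 0 := by linarith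
  have e4 : w y u = 1 := by
    rcases mul_eq_zero.1 e3 with h | h
    · exact absurd h (colourSign_ne_zero _)
    · linarith
  have e5 := hw.add_le_one (u := u) hxy
  rw [hw.symm u x, hw.symm u y, hw1, e4] at e5
  norm_num at e5

/-- `X` consists of vertices of degree two, its only vertex on a monochromatic edge is `l`, and
`x u` is the only edge with two colours that leaves `X`. -/
structure IsTail (G : SimpleGraph V) (c : V → Bool) (l : V) (X : Finset V) (x u : V) : Prop where
  mem : l ∈ X
  degree_eq : ∀ v ∈ X, G.degree v = 2
  eq_of_mono : ∀ v ∈ X, ∀ t, (monoGraph G c).Adj v t → v = l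
  exit_mem : x ∈ X
  top_notMem : u ∉ X
  adj : (cutGraph G c).Adj x u
  eq_of_adj : ∀ v ∈ X, ∀ t ∉ X, (cutGraph G c).Adj v t → v = x ∧ t = u

namespace IsTail

variable {l l' x x' u : V} {X X' : Finset V}

theorem exit_ne (h : IsTail G c l X x u) (h' : IsTail G c l' X' x' u) (hl : l ≠ l') : x ≠ x' := by
  rintro rfl
  have hsum := sum_signed_rows (X ∩ X') (fun v => colourSign (c v))
    (fun a b => if (cutGraph G c).Adj a b then 1 else 0)
    (fun a b => by simp only [(cutGraph G c).adj_comm a b]) (by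
      intro a _ b _ hab
      refine colourSign_add_eq_zero ?_
      by_contra hc
      exact hab (if_neg fun h => h.2 hc))
  simp only [sum_adj_eq_degree] at hsum
  have hdeg : ∀ v ∈ X ∩ X', colourSign (c v) * ((cutGraph G c).degree v : ℝ) =
      2 * ((if c v then 1 else -1 : ℤ) : ℝ) := by
    intro v hv
    obtain ⟨hv, hv'⟩ := Finset.mem_inter.1 hv
    have h0 : (monoGraph G c).degree v = 0 := by
      rw [← SimpleGraph.card_neighborFinset_eq_degree, Finset.card_eq_zero,
        Finset.eq_empty_iff_forall_notMem]
      intro t ht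
      rw [SimpleGraph.mem_neighborFinset] at ht
      exact hl ((h.eq_of_mono v hv t ht).symm.trans (h'.eq_of_mono v hv' t ht))
    have h2 := degree_cut_add_mono G c v
    rw [h0, h.degree_eq v hv, add_zero] at h2
    rw [h2]
    cases c v <;> simp [colourSign]
  have hexit : ∀ v ∈ X ∩ X', ∑ t ∈ (X ∩ X')ᶜ,
      colourSign (c v) * (if (cutGraph G c).Adj v t then (1 : ℝ) else 0) =
      if v = x then colourSign (c x) else 0 := by
    intro v hv
    obtain ⟨hv, hv'⟩ := Finset.mem_inter.1 hv
    have hz : ∀ t ∈ (X ∩ X')ᶜ, (cutGraph G c).Adj v t → v = x ∧ t = u := by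
      intro t ht hvt
      by_cases htX : t ∈ X
      · exact h'.eq_of_adj v hv' t (fun h => by simp [htX, h] at ht) hvt
      · exact h.eq_of_adj v hv t htX hvt
    split_ifs with hvx
    · subst hvx
      rw [Finset.sum_eq_single u, if_pos h.adj, mul_one]
      · intro t ht htu
        rw [if_neg fun hvt => htu (hz t ht hvt).2, mul_zero]
      · intro hu
        simp [h.top_notMem] at hu
    · refine Finset.sum_eq_zero fun t ht => ?_
      rw [if_neg fun hvt => hvx (hz t ht hvt).1, mul_zero]
  rw [Finset.sum_congr rfl hdeg, Finset.sum_congr rfl hexit, Finset.sum_ite_eq',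
    if_pos (Finset.mem_inter.2 ⟨h.exit_mem, h'.exit_mem⟩), ← Finset.mul_sum, ← Int.cast_sum] at hsum
  cases hcx : c x <;> rw [hcx] at hsum <;> simp only [colourSign] at hsum
  · have : 2 * (∑ v ∈ X ∩ X', (if c v then 1 else -1 : ℤ)) = -1 := by exact_mod_cast hsum
    omega
  · have : 2 * (∑ v ∈ X ∩ X', (if c v then 1 else -1 : ℤ)) = 1 := by exact_mod_cast hsum
    omega

theorem not_mono_top (hG : IsRobust G) (h : IsTail G c l X x u)
    (hl : ∀ t, (monoGraph G c).Adj l t → t = u) (hlu : (monoGraph G c).Adj l u) : False := by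
  refine hG.not_odd_loop (c := c) h.degree_eq h.exit_mem h.mem h.top_notMem h.adj.1 hlu.1 h.adj.2
    hlu.2 (fun v hv t ht hvt hc => ?_) fun v hv t ht hvt => ?_
  · have h1 := h.eq_of_mono v hv t ⟨hvt, hc⟩
    subst h1
    exact h.top_notMem (hl t ⟨hvt, hc⟩ ▸ ht)
  · rcases cut_or_mono (c := c) hvt with h1 | h1
    · exact ⟨(h.eq_of_adj v hv t ht h1).2, Or.inl (h.eq_of_adj v hv t ht h1).1⟩
    · have h2 := h.eq_of_mono v hv t h1
      subst h2
      exact ⟨hl t h1, Or.inr rfl⟩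

theorem not_mono_adj (hG : IsRobust G) (h : IsTail G c l X x u) (h' : IsTail G c l' X' x' u)
    (hll : (monoGraph G c).Adj l l') (hl : ∀ t, (monoGraph G c).Adj l t → t = l')
    (hl' : ∀ t, (monoGraph G c).Adj l' t → t = l) : False := by
  have hne := h.exit_ne h' hll.ne
  have hxX' : x ∉ X' := fun hx => hne (h'.eq_of_adj x hx u h'.top_notMem h.adj).1
  have hsw : ∀ v ∈ X', switch c X' v = !c v := fun v hv => if_pos hv
  have hsw' : ∀ v ∉ X', switch c X' v = c v := fun v hv => if_neg hv
  have hcross : ∀ v ∈ X', ∀ t ∈ X ∪ X', t ∉ X' → G.Adj v t → switch c X' v ≠ switch c X' t := by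
    intro v hv t ht ht' hvt hc
    rw [hsw v hv, hsw' t ht'] at hc
    have h1 := h'.eq_of_adj v hv t ht' ⟨hvt, fun h => by rw [h] at hc; simp at hc⟩
    rw [h1.2] at ht
    simp [h.top_notMem, h'.top_notMem] at ht
  have hsame : ∀ v, ∀ t, v ∈ X ∪ X' → t ∈ X ∪ X' → (v ∈ X' ↔ t ∈ X') → G.Adj v t →
      c v ≠ c t := by
    intro v t hv ht hvt hadj hc
    have hv' : v = l ∨ v = l' := by
      rcases Finset.mem_union.1 hv with hv | hv
      · exact Or.inl (h.eq_of_mono v hv t ⟨hadj, hc⟩)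
      · exact Or.inr (h'.eq_of_mono v hv t ⟨hadj, hc⟩)
    have hlX' : l ∉ X' := fun hlX' => hll.ne (h'.eq_of_mono l hlX' l' hll)
    rcases hv' with rfl | rfl
    · have := hl t ⟨hadj, hc⟩
      subst this
      exact hlX' (hvt.2 h'.mem)
    · have := hl' t ⟨hadj, hc⟩
      subst this
      exact hlX' (hvt.1 h'.mem)
  refine hG.not_odd_loop (c := switch c X') (Z := X ∪ X') (x := x) (y := x') (u := u) ?_
    (Finset.mem_union_left _ h.exit_mem) (Finset.mem_union_right _ h'.exit_mem)
    (by simp [h.top_notMem, h'.top_notMem]) h.adj.1 h'.adj.1 ?_ ?_ ?_ ?_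
  · intro v hv
    exact (Finset.mem_union.1 hv).elim (h.degree_eq v) (h'.degree_eq v)
  · rw [hsw' x hxX', hsw' u h'.top_notMem]
    exact h.adj.2
  · rw [hsw x' h'.exit_mem, hsw' u h'.top_notMem]
    have := h'.adj.2
    revert this
    cases c x' <;> cases c u <;> simp
  · intro v hv t ht hvt
    by_cases hv' : v ∈ X' <;> by_cases ht' : t ∈ X'
    · rw [hsw v hv', hsw t ht']
      intro hc
      exact hsame v t hv ht (by simp [hv', ht']) hvt (by simpa using hc)
    · exact hcross v hv' t ht ht' hvt
    · exact (hcross t ht' v hv hv' hvt.symm).symm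
    · rw [hsw' v hv', hsw' t ht']
      exact hsame v t hv ht (by simp [hv', ht']) hvt
  · intro v hv t ht hvt
    rw [Finset.mem_union, not_or] at ht
    rcases cut_or_mono (c := c) hvt with h1 | h1 <;> rcases Finset.mem_union.1 hv with h2 | h2
    · exact ⟨(h.eq_of_adj v h2 t ht.1 h1).2, Or.inl (h.eq_of_adj v h2 t ht.1 h1).1⟩
    · exact ⟨(h'.eq_of_adj v h2 t ht.2 h1).2, Or.inr (h'.eq_of_adj v h2 t ht.2 h1).1⟩
    · have h3 := h.eq_of_mono v h2 t h1
      subst h3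
      exact absurd (hl t h1 ▸ h'.mem) ht.2
    · have h3 := h'.eq_of_mono v h2 t h1
      subst h3
      exact absurd (hl' t h1 ▸ h.mem) ht.1

end IsTail

end Tails

section MaxCut

open scoped Classical

variable {V : Type*} [Fintype V] {G : SimpleGraph V} {c : V → Bool}

theorem IsMaxCut.degree_of_leaf (hc : IsMaxCut G c) (hG : IsRobust G) {l : V}
    (hl : (cutGraph G c).degree l = 1) : G.degree l = 2 ∧ (monoGraph G c).degree l = 1 := by
  have h1 := hc.degree_mono_le l
  have h2 := degree_cut_add_mono G c l
  have h3 := hG.two_le_degree l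
  omega

theorem IsMaxCut.exists_mono_neighbor (hc : IsMaxCut G c) (hG : IsRobust G) {l : V}
    (hl : (cutGraph G c).degree l = 1) :
    ∃ w, (monoGraph G c).Adj l w ∧ ∀ t, (monoGraph G c).Adj l t → t = w := by
  obtain ⟨w, hw⟩ := Finset.card_eq_one.1 (hc.degree_of_leaf hG hl).2
  have h : ∀ t, (monoGraph G c).Adj l t ↔ t = w := fun t => by
    rw [← SimpleGraph.mem_neighborFinset, hw, Finset.mem_singleton]
  exact ⟨w, (h w).2 rfl, fun t => (h t).1⟩

theorem IsMaxCut.exists_maximal_tail (hc : IsMaxCut G c) (hG : IsRobust G) {l : V}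
    (hl : (cutGraph G c).degree l = 1) :
    ∃ X x u, IsTail G c l X x u ∧ ∀ X' x' u', IsTail G c l X' x' u' → X'.card ≤ X.card := by
  obtain ⟨u, hu⟩ := Finset.card_eq_one.1 hl
  have h : ∀ t, (cutGraph G c).Adj l t ↔ t = u := fun t => by
    rw [← SimpleGraph.mem_neighborFinset, hu, Finset.mem_singleton]
  have h0 : IsTail G c l {l} l u :=
    { mem := Finset.mem_singleton_self l
      degree_eq := fun v hv => by
        rw [Finset.mem_singleton.1 hv]
        exact (hc.degree_of_leaf hG hl).1
      eq_of_mono := fun v hv t _ => Finset.mem_singleton.1 hv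
      exit_mem := Finset.mem_singleton_self l
      top_notMem := by
        rw [Finset.mem_singleton]
        exact ((h u).2 rfl).ne'
      adj := (h u).2 rfl
      eq_of_adj := fun v hv t _ hvt => by
        rw [Finset.mem_singleton] at hv
        subst hv
        exact ⟨rfl, (h t).1 hvt⟩ }
  obtain ⟨X, hX, hmax⟩ := Finset.exists_max_image
    (Finset.univ.filter fun X : Finset V => ∃ x u, IsTail G c l X x u) Finset.card
    ⟨{l}, by simpa using ⟨l, u, h0⟩⟩
  obtain ⟨-, x, u, hXu⟩ := Finset.mem_filter.1 hX
  exact ⟨X, x, u, hXu, fun X' x' u' h' => hmax X' (by simpa using ⟨x', u', h'⟩)⟩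

/-- A tail whose top has degree two can be extended. -/
theorem IsTail.extend {l x u : V} {X : Finset V} (h : IsTail G c l X x u)
    (hu : G.degree u = 2) (hu' : (monoGraph G c).degree u = 0) :
    ∃ t, IsTail G c l (insert u X) u t := by
  have hd := degree_cut_add_mono G c u
  rw [hu, hu', add_zero, ← SimpleGraph.card_neighborFinset_eq_degree] at hd
  obtain ⟨a, b, hab, hN⟩ := Finset.card_eq_two.1 hd
  obtain ⟨t, htx, hN⟩ : ∃ t, t ≠ x ∧ ∀ y, (cutGraph G c).Adj u y ↔ y = t ∨ y = x := by
    have hN' : ∀ y, (cutGraph G c).Adj u y ↔ y = a ∨ y = b := fun y => by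
      rw [← SimpleGraph.mem_neighborFinset, hN]; simp
    rcases (hN' x).1 h.adj.symm with rfl | rfl
    · exact ⟨b, hab.symm, fun y => by rw [hN', or_comm]⟩
    · exact ⟨a, hab, hN'⟩
  have hut := (hN t).2 (Or.inl rfl)
  refine ⟨t, Finset.mem_insert_of_mem h.mem, ?_, ?_, Finset.mem_insert_self _ _, ?_, hut, ?_⟩
  · intro v hv
    rcases Finset.mem_insert.1 hv with rfl | hv
    · exact hu
    · exact h.degree_eq v hv
  · intro v hv s hvs
    rcases Finset.mem_insert.1 hv with rfl | hv
    · rw [← SimpleGraph.card_neighborFinset_eq_degree, Finset.card_eq_zero] at hu'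
      exact absurd ((SimpleGraph.mem_neighborFinset _ _ _).2 hvs) (by simp [hu'])
    · exact h.eq_of_mono v hv s hvs
  · rw [Finset.mem_insert, not_or]
    exact ⟨hut.ne', fun htX => htx (h.eq_of_adj t htX u h.top_notMem hut.symm).1⟩
  · intro v hv s hs hvs
    rw [Finset.mem_insert, not_or] at hs
    rcases Finset.mem_insert.1 hv with rfl | hv
    · refine ⟨rfl, ((hN s).1 hvs).resolve_right ?_⟩
      rintro rfl
      exact hs.2 h.exit_mem
    · exact absurd (h.eq_of_adj v hv s hs.2 hvs).2 hs.1

/-- The number of maximal tails with a given top. -/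
theorem IsMaxCut.card_tails_le (hc : IsMaxCut G c) (hG : IsRobust G) {u : V} {L : Finset V}
    (hL : L.Nonempty) (hleaf : ∀ l ∈ L, (cutGraph G c).degree l = 1) {X : V → Finset V} {x : V → V}
    (hX : ∀ l ∈ L, IsTail G c l (X l) (x l) u)
    (hmax : ∀ l ∈ L, ∀ X' x' u', IsTail G c l X' x' u' → X'.card ≤ (X l).card) :
    L.card + 2 ≤ (cutGraph G c).degree u := by
  by_contra hlt
  have hw : ∀ l, ∃ w, l ∈ L →
      (monoGraph G c).Adj l w ∧ ∀ t, (monoGraph G c).Adj l t → t = w := by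
    intro l
    by_cases hl : l ∈ L
    · obtain ⟨w, h⟩ := hc.exists_mono_neighbor hG (hleaf l hl)
      exact ⟨w, fun _ => h⟩
    · exact ⟨l, fun h => absurd h hl⟩
  choose w hw using hw
  have hwu : ∀ l ∈ L, w l ≠ u := fun l hl h =>
    (hX l hl).not_mono_top hG (h ▸ (hw l hl).2) (h ▸ (hw l hl).1)
  have hwX : ∀ l ∈ L, ∀ l' ∈ L, w l ∉ X l' := by
    intro l hl l' hl' hmem
    have h1 : w l = l' := (hX l' hl').eq_of_mono _ hmem l (hw l hl).1.symm
    have h2 : w l' = l := ((hw l' hl').2 l (h1 ▸ (hw l hl).1.symm)).symm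
    exact (hX l hl).not_mono_adj hG (hX l' hl') (h1 ▸ (hw l hl).1) (h1 ▸ (hw l hl).2)
      (h2 ▸ (hw l' hl').2)
  set Z : Finset V := insert u (L.biUnion X) with hZ
  have hlZ : ∀ l ∈ L, l ∈ Z := fun l hl =>
    Finset.mem_insert_of_mem (Finset.mem_biUnion.2 ⟨l, hl, (hX l hl).mem⟩)
  have hxinj : Set.InjOn x L := by
    intro l hl l' hl' h
    by_contra hne
    exact (hX l hl).exit_ne (hX l' hl') hne h
  have hcut : (crossing (cutGraph G c) Z).card + L.card ≤ (cutGraph G c).degree u := by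
    rw [← Finset.card_image_of_injOn hxinj, ← SimpleGraph.card_neighborFinset_eq_degree]
    have hle : (crossing (cutGraph G c) Z).card ≤
        ((cutGraph G c).neighborFinset u \ L.image x).card := by
      refine Finset.card_le_card_of_injOn Prod.snd ?_ ?_
      · rintro ⟨v, t⟩ hvt
        obtain ⟨hv, ht, hadj⟩ := mem_crossing.1 hvt
        simp only [hZ, Finset.mem_insert, Finset.mem_biUnion, not_or, not_exists, not_and] at hv ht
        rcases hv with rfl | ⟨l, hl, hv⟩
        · simp only [Finset.coe_sdiff, Set.mem_sdiff, Finset.mem_coe,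
            SimpleGraph.mem_neighborFinset, Finset.mem_image, not_exists, not_and]
          refine ⟨hadj, fun l hl h => ht.2 l hl ?_⟩
          rw [← h]
          exact (hX l hl).exit_mem
        · exact absurd ((hX l hl).eq_of_adj v hv t (ht.2 l hl) hadj).2 ht.1
      · rintro ⟨v, t⟩ hvt ⟨v', t'⟩ hvt' (rfl : t = t')
        have huniq : ∀ v, (v, t) ∈ crossing (cutGraph G c) Z → v = u := by
          intro v hvt
          obtain ⟨hv, ht, hvt⟩ := mem_crossing.1 hvt
          simp only [hZ, Finset.mem_insert, Finset.mem_biUnion, not_or, not_exists,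
            not_and] at hv ht
          rcases hv with rfl | ⟨l, hl, hv⟩
          · rfl
          · exact absurd ((hX l hl).eq_of_adj v hv t (ht.2 l hl) hvt).2 ht.1
        rw [huniq v hvt, huniq v' hvt']
    have hsub : L.image x ⊆ (cutGraph G c).neighborFinset u := by
      intro y hy
      obtain ⟨l, hl, rfl⟩ := Finset.mem_image.1 hy
      rw [SimpleGraph.mem_neighborFinset]
      exact (hX l hl).adj.symm
    have := Finset.card_sdiff_add_card_eq_card hsub
    omega
  have hmono : L.card + (monoGraph G c).degree u ≤ (crossing (monoGraph G c) Z).card := by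
    rw [← SimpleGraph.card_neighborFinset_eq_degree,
      ← Finset.card_image_of_injective (f := fun l => (l, w l)) L (fun a b h => (Prod.ext_iff.1 h).1),
      ← Finset.card_image_of_injective (f := fun t => (u, t))
        ((monoGraph G c).neighborFinset u) (fun a b h => (Prod.ext_iff.1 h).2),
      ← Finset.card_union_of_disjoint]
    · refine Finset.card_le_card ?_
      rintro p hp
      rw [mem_crossing]
      rcases Finset.mem_union.1 hp with hp | hp
      · obtain ⟨l, hl, rfl⟩ := Finset.mem_image.1 hp
        refine ⟨hlZ l hl, ?_, (hw l hl).1⟩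
        simp only [hZ, Finset.mem_insert, Finset.mem_biUnion, not_or, not_exists, not_and]
        exact ⟨hwu l hl, hwX l hl⟩
      · obtain ⟨t, ht, rfl⟩ := Finset.mem_image.1 hp
        rw [SimpleGraph.mem_neighborFinset] at ht
        refine ⟨Finset.mem_insert_self _ _, ?_, ht⟩
        simp only [hZ, Finset.mem_insert, Finset.mem_biUnion, not_or, not_exists, not_and]
        refine ⟨ht.ne', fun l hl htX => ?_⟩
        have h1 := (hX l hl).eq_of_mono t htX u ht.symm
        subst h1
        exact hwu t hl ((hw t hl).2 u ht.symm).symm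
    · rw [Finset.disjoint_left]
      intro p hp hp'
      obtain ⟨l, hl, rfl⟩ := Finset.mem_image.1 hp
      obtain ⟨t, -, ht⟩ := Finset.mem_image.1 hp'
      have hul : u = l := (Prod.ext_iff.1 ht).1
      exact (hX l hl).top_notMem (by rw [hul]; exact (hX l hl).mem)
  have h1 := hc.card_crossing_le Z
  have h2 := degree_cut_add_mono G c u
  have h3 := hG.two_le_degree u
  have h4 := hL.card_pos
  obtain ⟨l, hl⟩ := hL
  obtain ⟨t, ht⟩ := (hX l hl).extend (by omega) (by omega)
  have h5 := hmax l hl _ _ _ ht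
  rw [Finset.card_insert_of_notMem (hX l hl).top_notMem] at h5
  omega

/-- A maximum cut of a robust graph has at least as many edges as there are vertices. -/
theorem IsMaxCut.two_mul_card_le (hc : IsMaxCut G c) (hG : IsRobust G) :
    2 * Fintype.card V ≤ ∑ v, (cutGraph G c).degree v := by
  have hex : ∀ l, ∃ (X : Finset V) (x u : V), (cutGraph G c).degree l = 1 →
      IsTail G c l X x u ∧ ∀ X' x' u', IsTail G c l X' x' u' → X'.card ≤ X.card := by
    intro l
    by_cases hl : (cutGraph G c).degree l = 1
    · obtain ⟨X, x, u, h⟩ := hc.exists_maximal_tail hG hl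
      exact ⟨X, x, u, fun _ => h⟩
    · exact ⟨∅, l, l, fun h => absurd h hl⟩
  choose X x top hT using hex
  set L : Finset V := Finset.univ.filter fun l => (cutGraph G c).degree l = 1 with hLdef
  have hcard : L.card = ∑ u, (L.filter fun l => top l = u).card :=
    Finset.card_eq_sum_card_fiberwise fun _ _ => Finset.mem_coe.2 (Finset.mem_univ _)
  have hLsum : L.card = ∑ u : V, if (cutGraph G c).degree u = 1 then 1 else 0 := by
    rw [hLdef, Finset.card_filter]
  have hpt : ∀ u, 2 + (L.filter fun l => top l = u).card ≤
      (cutGraph G c).degree u + if (cutGraph G c).degree u = 1 then 1 else 0 := by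
    intro u
    rcases (L.filter fun l => top l = u).eq_empty_or_nonempty with h0 | h0
    · rw [h0, Finset.card_empty]
      have h1 := hc.degree_mono_le u
      have h2 := degree_cut_add_mono G c u
      have h3 := hG.two_le_degree u
      split_ifs <;> omega
    · have h1 := hc.card_tails_le hG (u := u) h0 (X := X) (x := x)
        (fun l hl => by simpa [hLdef] using (Finset.mem_filter.1 hl).1)
        (fun l hl => by
          obtain ⟨hl, rfl⟩ := Finset.mem_filter.1 hl
          exact (hT l (by simpa [hLdef] using hl)).1)
        (fun l hl => (hT l (by simpa [hLdef] using (Finset.mem_filter.1 hl).1)).2)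
      omega
  have hsum := Finset.sum_le_sum fun u (_ : u ∈ Finset.univ) => hpt u
  rw [Finset.sum_add_distrib, Finset.sum_add_distrib, ← hcard, ← hLsum] at hsum
  simp only [Finset.sum_const, Finset.card_univ, smul_eq_mul] at hsum
  omega

end MaxCut

section LowerBound

open scoped Classical

variable {V : Type*} [Fintype V] {G : SimpleGraph V} {c : V → Bool}

/-- The ordered pairs of adjacent vertices of colour `b`. -/
noncomputable def monoPairs (G : SimpleGraph V) (c : V → Bool) (b : Bool) : Finset (V × V) :=
  Finset.univ.filter fun p => (monoGraph G c).Adj p.1 p.2 ∧ c p.1 = b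

theorem mem_monoPairs {b : Bool} {p : V × V} :
    p ∈ monoPairs G c b ↔ (monoGraph G c).Adj p.1 p.2 ∧ c p.1 = b := by
  simp [monoPairs]

theorem swap_mem_monoPairs {b : Bool} {u v : V} (h : (u, v) ∈ monoPairs G c b) :
    (v, u) ∈ monoPairs G c b := by
  rw [mem_monoPairs] at h ⊢
  exact ⟨h.1.symm, h.1.2.symm.trans h.2⟩

theorem sum_degree_mono (G : SimpleGraph V) (c : V → Bool) :
    ∑ v, (monoGraph G c).degree v = (monoPairs G c true).card + (monoPairs G c false).card := by
  rw [← Finset.card_union_of_disjoint]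
  · have h : ∀ v, (monoGraph G c).degree v =
        ∑ u, if (monoGraph G c).Adj v u then 1 else 0 := by
      intro v
      rw [← Finset.card_filter, ← SimpleGraph.card_neighborFinset_eq_degree]
      congr 1
      ext u
      simp
    rw [Finset.sum_congr rfl fun v _ => h v, ← Fintype.sum_prod_type'
      (f := fun v u => if (monoGraph G c).Adj v u then 1 else 0), ← Finset.card_filter]
    congr 1
    ext p
    simp only [Finset.mem_filter, Finset.mem_univ, true_and, Finset.mem_union, mem_monoPairs]
    cases c p.1 <;> simp
  · rw [Finset.disjoint_left]
    intro p hp hp'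
    rw [mem_monoPairs] at hp hp'
    exact absurd (hp.2.symm.trans hp'.2) (by simp)

theorem sum_signed_cut (c : V → Bool) (w : V → V → ℝ) (hw : ∀ u v, w u v = w v u)
    (h0 : ∀ u v, c u = c v → w u v = 0) : ∑ u, colourSign (c u) * ∑ v, w u v = 0 := by
  rw [sum_signed_rows Finset.univ _ w hw]
  · simp
  · exact fun u _ v _ h => colourSign_add_eq_zero fun hc => h (h0 u v hc)

/-- The difference of the sizes of the colour classes in terms of the monochromatic edges. -/
theorem IsMatchingWeight.sum_colourSign {w : V → V → ℝ} (hw : IsMatchingWeight G w)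
    (c : V → Bool) : ∑ v, colourSign (c v) =
      ∑ p ∈ monoPairs G c true, w p.1 p.2 - ∑ p ∈ monoPairs G c false, w p.1 p.2 := by
  have h1 := sum_signed_cut c (fun u v => if c u = c v then 0 else w u v)
    (fun u v => by simp only [hw.symm u v, eq_comm (a := c u)]) (fun u v h => if_pos h)
  have h2 : ∀ v, colourSign (c v) =
      colourSign (c v) * ∑ u, (if c v = c u then 0 else w v u) +
        ∑ u, if c v = c u then colourSign (c v) * w v u else 0 := by
    intro v
    rw [Finset.mul_sum, ← Finset.sum_add_distrib]
    conv_lhs => rw [← mul_one (colourSign (c v)), ← hw.sum_eq v, Finset.mul_sum]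
    refine Finset.sum_congr rfl fun u _ => ?_
    split_ifs <;> simp
  rw [Finset.sum_congr rfl fun v _ => h2 v, Finset.sum_add_distrib, h1, zero_add,
    ← Fintype.sum_prod_type' (f := fun v u => if c v = c u then colourSign (c v) * w v u else 0),
    monoPairs, monoPairs, Finset.sum_filter, Finset.sum_filter, ← Finset.sum_sub_distrib]
  refine Finset.sum_congr rfl fun p _ => ?_
  by_cases hp : G.Adj p.1 p.2
  · by_cases hc : c p.1 = c p.2
    · simp only [monoGraph_adj, hp, hc, true_and, if_true]
      cases c p.2 <;> simp [colourSign]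
    · simp [monoGraph_adj, hc]
  · simp [monoGraph_adj, hp, hw.supp _ _ hp]

theorem IsMaxCut.sum_degree_ge_of_pos (hc : IsMaxCut G c) (hG : IsRobust G)
    (hodd : Odd (∑ v, (if c v then 1 else -1 : ℤ))) (hpos : 0 < ∑ v, (if c v then 1 else -1 : ℤ)) :
    2 * Fintype.card V + 6 ≤ ∑ v, G.degree v := by
  set D : ℤ := ∑ v, (if c v then 1 else -1 : ℤ) with hD
  have hDR : ∑ v, colourSign (c v) = (D : ℝ) := by
    rw [hD, Int.cast_sum]
    refine Finset.sum_congr rfl fun v _ => ?_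
    cases c v <;> simp [colourSign]
  have hD1 : (1 : ℝ) ≤ D := by exact_mod_cast hpos
  have hdeg : ∑ v, G.degree v = ∑ v, (cutGraph G c).degree v + ∑ v, (monoGraph G c).degree v := by
    rw [← Finset.sum_add_distrib]
    exact Finset.sum_congr rfl fun v _ => (degree_cut_add_mono G c v).symm
  rw [sum_degree_mono] at hdeg
  have hcut := hc.two_mul_card_le hG
  by_contra hlt
  have hEven : Even (∑ v, G.degree v) := by
    rw [SimpleGraph.sum_degrees_eq_twice_card_edges]
    exact even_two_mul _
  have hle : (monoPairs G c true).card + (monoPairs G c false).card ≤ 4 := by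
    obtain ⟨k, hk⟩ := hEven
    omega
  have hle_true : ∀ w, IsMatchingWeight G w → (1 : ℝ) ≤ ∑ p ∈ monoPairs G c true, w p.1 p.2 := by
    intro w hw
    have h := hw.sum_colourSign c
    have h' : 0 ≤ ∑ p ∈ monoPairs G c false, w p.1 p.2 :=
      Finset.sum_nonneg fun p _ => hw.nonneg _ _
    rw [hDR] at h
    linarith
  have hne : ∀ w, IsMatchingWeight G w → ∃ a b, (a, b) ∈ monoPairs G c true ∧ w a b ≠ 0 := by
    intro w hw
    obtain ⟨⟨a, b⟩, h, h'⟩ := Finset.exists_ne_zero_of_sum_ne_zero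
      (fun h => by have := hle_true w hw; rw [h] at this; norm_num at this)
    exact ⟨a, b, h, h'⟩
  obtain ⟨w₀, hw₀⟩ := hG.exists_weight
  obtain ⟨a, b, hab, -⟩ := hne w₀ hw₀
  have hab' := mem_monoPairs.1 hab
  obtain ⟨w₁, hw₁, h0⟩ := hG.avoid a b hab'.1.1
  have h0' : w₁ b a = 0 := by rw [hw₁.symm, h0]
  obtain ⟨a', b', hab₁, h1⟩ := hne w₁ hw₁
  have hne' := (mem_monoPairs.1 hab₁).1.1.ne
  have hcard2 : ({(a, b), (b, a)} : Finset (V × V)).card = 2 :=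
    Finset.card_pair fun h => hab'.1.1.ne (Prod.ext_iff.1 h).1
  have hcard2' : ({(a', b'), (b', a')} : Finset (V × V)).card = 2 :=
    Finset.card_pair fun h => hne' (Prod.ext_iff.1 h).1
  have hsub : ({(a, b), (b, a)} : Finset (V × V)) ⊆ monoPairs G c true := by
    simp [Finset.insert_subset_iff, hab, swap_mem_monoPairs hab]
  have hsub' : ({(a', b'), (b', a')} : Finset (V × V)) ⊆
      monoPairs G c true \ {(a, b), (b, a)} := by
    have h1' : w₁ b' a' ≠ 0 := by rwa [hw₁.symm]
    have hout : ∀ p : V × V, w₁ p.1 p.2 ≠ 0 → p ∉ ({(a, b), (b, a)} : Finset (V × V)) := by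
      intro p hp hp'
      rcases Finset.mem_insert.1 hp' with rfl | hp'
      · exact hp h0
      · rw [Finset.mem_singleton] at hp'
        subst hp'
        exact hp h0'
    simp only [Finset.insert_subset_iff, Finset.singleton_subset_iff, Finset.mem_sdiff]
    exact ⟨⟨hab₁, hout (a', b') h1⟩, swap_mem_monoPairs hab₁, hout (b', a') h1'⟩
  have hge := Finset.card_le_card hsub'
  have hsd := Finset.card_sdiff_add_card_eq_card hsub
  have htrue : (monoPairs G c true).card = 4 := by omega
  have hfalse : monoPairs G c false = ∅ := Finset.card_eq_zero.1 (by omega)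
  have hDle : (D : ℝ) ≤ 2 := by
    rw [← hDR, hw₁.sum_colourSign c, hfalse, Finset.sum_empty, sub_zero,
      ← Finset.sum_sdiff hsub, Finset.sum_pair fun h => hab'.1.1.ne (Prod.ext_iff.1 h).1]
    simp only [h0, h0', add_zero]
    refine (Finset.sum_le_card_nsmul _ _ 1 fun p _ => hw₁.le_one _ _).trans ?_
    rw [show (monoPairs G c true \ {(a, b), (b, a)}).card = 2 by omega]
    norm_num
  have hDeq : D = 1 := by
    have : D ≤ 2 := by exact_mod_cast hDle
    obtain ⟨k, hk⟩ := hodd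
    omega
  have hnoleaf : ∀ u, c u = true → 2 ≤ (cutGraph G c).degree u := by
    intro u hu
    by_contra h
    have hu1 : (cutGraph G c).degree u = 1 := by
      have h1 := hc.degree_mono_le u
      have h2 := degree_cut_add_mono G c u
      have h3 := hG.two_le_degree u
      omega
    obtain ⟨v, huv, -⟩ := hc.exists_mono_neighbor hG hu1
    obtain ⟨w, hw, hw1⟩ := hG.exists_weight_eq_one huv.1 (hc.degree_of_leaf hG hu1).1
    have h1 := hw.sum_colourSign c
    rw [hDR, hDeq, hfalse, Finset.sum_empty, sub_zero] at h1
    have hm : (u, v) ∈ monoPairs G c true := mem_monoPairs.2 ⟨huv, hu⟩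
    have h2 := Finset.sum_le_sum_of_subset_of_nonneg (f := fun p : V × V => w p.1 p.2)
      (s := {(u, v), (v, u)}) (t := monoPairs G c true)
      (by simp [Finset.insert_subset_iff, hm, swap_mem_monoPairs hm]) (fun p _ _ => hw.nonneg _ _)
    rw [Finset.sum_pair fun h => huv.1.ne (Prod.ext_iff.1 h).1, ← h1] at h2
    simp only [hw.symm v u, hw1] at h2
    norm_num at h2
  have hbip := sum_signed_cut c (fun u v => if (cutGraph G c).Adj u v then 1 else 0)
    (fun u v => by simp only [(cutGraph G c).adj_comm u v]) (fun u v h => if_neg fun h' => h'.2 h)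
  simp only [sum_adj_eq_degree] at hbip
  have hpt : ∀ v, 2 * (colourSign (c v) + 1) ≤
      colourSign (c v) * ((cutGraph G c).degree v : ℝ) + ((cutGraph G c).degree v : ℝ) := by
    intro v
    cases hv : c v
    · simp [colourSign]
    · have : (2 : ℝ) ≤ (cutGraph G c).degree v := by exact_mod_cast hnoleaf v hv
      simp only [colourSign]
      linarith
  have hsum := Finset.sum_le_sum fun v (_ : v ∈ Finset.univ) => hpt v
  rw [← Finset.mul_sum, Finset.sum_add_distrib, Finset.sum_add_distrib, hbip, hDR, hDeq] at hsum
  simp only [Finset.sum_const, Finset.card_univ, nsmul_eq_mul, Int.cast_one, mul_one,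
    zero_add] at hsum
  have hfin : 2 * (1 + Fintype.card V) ≤ ∑ v, (cutGraph G c).degree v := by exact_mod_cast hsum
  omega

/-- A robust graph of odd order `n` has at least `n + 3` edges. -/
theorem IsRobust.card_add_three_le (hG : IsRobust G) (hodd : Odd (Fintype.card V)) :
    Fintype.card V + 3 ≤ G.edgeSet.ncard := by
  suffices h : 2 * Fintype.card V + 6 ≤ ∑ v, G.degree v by
    rw [SimpleGraph.sum_degrees_eq_twice_card_edges] at h
    rw [Set.ncard_eq_toFinset_card']
    have : G.edgeSet.toFinset.card = G.edgeFinset.card := rfl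
    omega
  have hsgn : ∀ c : V → Bool, Odd (∑ v, (if c v then 1 else -1 : ℤ)) := by
    intro c
    have h : ∑ v, (if c v then 1 else -1 : ℤ) =
        2 * (∑ v, if c v then 1 else 0 : ℤ) - Fintype.card V := by
      rw [Finset.mul_sum, ← nsmul_one (Fintype.card V), ← Finset.card_univ, ← Finset.sum_const,
        ← Finset.sum_sub_distrib]
      exact Finset.sum_congr rfl fun v _ => by split_ifs <;> norm_num
    rw [h]
    obtain ⟨k, hk⟩ := hodd
    exact ⟨(∑ v, if c v then 1 else 0 : ℤ) - k - 1, by rw [hk]; push_cast; ring⟩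
  obtain ⟨c, hc⟩ := exists_isMaxCut G
  rcases lt_trichotomy 0 (∑ v, (if c v then 1 else -1 : ℤ)) with h | h | h
  · exact hc.sum_degree_ge_of_pos hG (hsgn c) h
  · exact absurd (hsgn c) (by rw [← h]; decide)
  · have hcut : cutGraph G (fun v => !c v) = cutGraph G c := by
      ext u v
      simp [cutGraph_adj]
    have hc' : IsMaxCut G (fun v => !c v) := by
      intro c'
      exact (hc c').trans_eq (congrArg (fun H : SimpleGraph V => ∑ v, H.degree v) hcut.symm)
    refine hc'.sum_degree_ge_of_pos hG (hsgn _) ?_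
    have h1 : ∑ v, (if (!c v) = true then 1 else -1 : ℤ) =
        - ∑ v, (if c v then 1 else -1 : ℤ) := by
      rw [← Finset.sum_neg_distrib]
      exact Finset.sum_congr rfl fun v _ => by cases c v <;> simp
    rw [h1]
    omega

end LowerBound

section Construction

/-- An injective map sending every vertex to a neighbour gives a fractional perfect matching. -/
theorem isMatchingWeight_of_injective {V : Type*} [Fintype V] [DecidableEq V] {G : SimpleGraph V}
    {σ : V → V} (hσ : Function.Injective σ) (hadj : ∀ v, G.Adj v (σ v)) :
    IsMatchingWeight G fun u v => ((if σ u = v then 1 else 0) + if σ v = u then 1 else 0) / 2 where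
  symm u v := by ring
  nonneg u v := by positivity
  supp u v h := by
    have h1 : σ u ≠ v := fun h' => h (h' ▸ hadj u)
    have h2 : σ v ≠ u := fun h' => h (h' ▸ hadj v).symm
    simp [h1, h2]
  sum_eq u := by
    obtain ⟨x, hx⟩ := (Finite.injective_iff_surjective.1 hσ) u
    have h1 : ∑ v, (if σ v = u then 1 else 0 : ℝ) = 1 := by
      rw [Finset.sum_eq_single x, if_pos hx]
      · exact fun b _ hb => if_neg fun h => hb (hσ (h.trans hx.symm))
      · simp
    rw [← Finset.sum_div, Finset.sum_add_distrib, h1]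
    simp

/-- Every edge is avoided by an injective map that sends every vertex to a neighbour. -/
def HasAvoidingMaps {V : Type*} (G : SimpleGraph V) : Prop :=
  ∀ a b, G.Adj a b → ∃ σ : V → V, Function.Injective σ ∧ (∀ v, G.Adj v (σ v)) ∧
    σ a ≠ b ∧ σ b ≠ a

theorem HasAvoidingMaps.comap {V W : Type*} {G : SimpleGraph W} (hG : HasAvoidingMaps G)
    (e : V ≃ W) : HasAvoidingMaps (G.comap e) := by
  intro a b hab
  obtain ⟨σ, hσ, hadj, ha, hb⟩ := hG (e a) (e b) hab
  refine ⟨fun v => e.symm (σ (e v)), fun u v h => e.injective (hσ (e.symm.injective h)),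
    fun v => ?_, fun h => ha ?_, fun h => hb ?_⟩
  · simpa using hadj (e v)
  · rw [← h, e.apply_symm_apply]
  · rw [← h, e.apply_symm_apply]

theorem HasAvoidingMaps.fmp_eq_two {V : Type*} [Fintype V] {G : SimpleGraph V}
    (hG : HasAvoidingMaps G) {x y z : V} (hyz : y ≠ z) (hx : ∀ v, G.Adj x v ↔ v = y ∨ v = z) :
    fmp G = 2 := by
  classical
  have hxy := (hx y).2 (Or.inl rfl)
  have hxz := (hx z).2 (Or.inr rfl)
  have hmem : ∃ F : Finset (Sym2 V), IsFMPSet G F ∧ F.card = 2 := by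
    refine ⟨{s(x, y), s(x, z)}, ⟨?_, ?_⟩, ?_⟩
    · simp [Set.insert_subset_iff, hxy, hxz]
    · rintro ⟨f, hf⟩
      have hw := hf.isMatchingWeight
      have h1 := hw.sum_eq x
      rw [Finset.sum_eq_zero fun v _ => hw.supp x v ?_] at h1
      · exact zero_ne_one h1
      · intro h
        rw [SimpleGraph.deleteEdges_adj] at h
        rcases (hx v).1 h.1 with rfl | rfl
        · exact h.2 (by simp)
        · exact h.2 (by simp)
    · exact Finset.card_pair fun h => hyz (Sym2.congr_right.1 h)
  refine le_antisymm (Nat.sInf_le hmem) ?_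
  refine le_csInf ⟨2, hmem⟩ ?_
  rintro k ⟨F, ⟨hF, hno⟩, rfl⟩
  by_contra hlt
  obtain ⟨a, b, hab, hFab⟩ : ∃ a b, G.Adj a b ∧ ∀ e ∈ F, e = s(a, b) := by
    rcases F.eq_empty_or_nonempty with rfl | ⟨e, he⟩
    · exact ⟨x, y, hxy, by simp⟩
    · induction e with
      | h a b =>
        exact ⟨a, b, hF he, fun e' he' => Finset.card_le_one.1 (by omega) e' he' _ he⟩
  obtain ⟨σ, hσ, hadj, ha, hb⟩ := hG a b hab
  refine hno ⟨_, (isMatchingWeight_of_injective hσ fun v => ?_).isFractionalPerfectMatching⟩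
  rw [SimpleGraph.deleteEdges_adj]
  refine ⟨hadj v, fun h => ?_⟩
  rcases Sym2.eq_iff.1 (hFab _ h) with ⟨rfl, h⟩ | ⟨rfl, h⟩
  · exact ha h
  · exact hb h

/-- The wheel with four spokes and centre `0`. -/
def fourWheel : SimpleGraph (Fin 5) where
  Adj u v := u ≠ v ∧ (u = 0 ∨ v = 0 ∨ (u.val + v.val) % 2 = 1)
  symm := ⟨by decide⟩
  loopless := ⟨by decide⟩

instance : DecidableRel fourWheel.Adj := fun u v =>
  inferInstanceAs (Decidable (u ≠ v ∧ (u = 0 ∨ v = 0 ∨ (u.val + v.val) % 2 = 1)))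

theorem hasAvoidingMaps_fourWheel : HasAvoidingMaps fourWheel := by
  have h : ∀ a b : Fin 5, fourWheel.Adj a b →
      ∃ σ ∈ [![1, 2, 0, 4, 3], ![3, 2, 1, 4, 0], ![2, 4, 3, 0, (1 : Fin 5)]],
        Function.Injective σ ∧ (∀ v, fourWheel.Adj v (σ v)) ∧ σ a ≠ b ∧ σ b ≠ a := by
    decide
  exact fun a b hab => let ⟨σ, _, hσ⟩ := h a b hab; ⟨σ, hσ⟩

variable {k : ℕ}

/-- One of the two perfect matchings of the even cycle. -/
def rungMap (p : ZMod (k + 2) × Bool) : ZMod (k + 2) × Bool := (p.1, !p.2)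

/-- The other perfect matching of the even cycle. -/
def stepMap (p : ZMod (k + 2) × Bool) : ZMod (k + 2) × Bool :=
  (if p.2 then p.1 + 1 else p.1 - 1, !p.2)

theorem rungMap_involutive : Function.Involutive (rungMap (k := k)) := by
  rintro ⟨i, b⟩
  simp [rungMap]

theorem stepMap_involutive : Function.Involutive (stepMap (k := k)) := by
  rintro ⟨i, b⟩
  cases b <;> simp [stepMap]

theorem rungMap_ne_stepMap (p : ZMod (k + 2) × Bool) : rungMap p ≠ stepMap p := by
  have : Fact (1 < k + 2) := ⟨by omega⟩
  rcases p with ⟨i, _ | _⟩ <;> simp [rungMap, stepMap, sub_eq_add_neg]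

/-- The cycle of length `2 * (k + 2)`. -/
def evenCycle (k : ℕ) : SimpleGraph (ZMod (k + 2) × Bool) where
  Adj p q := q = rungMap p ∨ q = stepMap p
  symm := ⟨by
    rintro p q (rfl | rfl)
    · exact Or.inl (rungMap_involutive p).symm
    · exact Or.inr (stepMap_involutive p).symm⟩
  loopless := ⟨by
    rintro ⟨i, b⟩ (h | h) <;> simp [rungMap, stepMap] at h⟩

theorem evenCycle_adj {p q : ZMod (k + 2) × Bool} :
    (evenCycle k).Adj p q ↔ q = rungMap p ∨ q = stepMap p := Iff.rfl

theorem hasAvoidingMaps_evenCycle : HasAvoidingMaps (evenCycle k) := by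
  rintro p q (rfl | rfl)
  · refine ⟨stepMap, stepMap_involutive.injective, fun v => Or.inr rfl,
      (rungMap_ne_stepMap p).symm, fun h => rungMap_ne_stepMap p ?_⟩
    rw [← stepMap_involutive (rungMap p), h]
  · refine ⟨rungMap, rungMap_involutive.injective, fun v => Or.inl rfl,
      rungMap_ne_stepMap p, fun h => rungMap_ne_stepMap p ?_⟩
    rw [← rungMap_involutive (stepMap p), h]

theorem HasAvoidingMaps.sum {V W : Type*} {G : SimpleGraph V} {H : SimpleGraph W}
    (hG : HasAvoidingMaps G) (hH : HasAvoidingMaps H) {a b : V} (hab : G.Adj a b) {p q : W}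
    (hpq : H.Adj p q) : HasAvoidingMaps (G ⊕g H) := by
  have key : ∀ (σ : V → V) (τ : W → W), Function.Injective σ → Function.Injective τ →
      (∀ v, G.Adj v (σ v)) → (∀ v, H.Adj v (τ v)) →
      Function.Injective (Sum.map σ τ) ∧ ∀ v, (G ⊕g H).Adj v (Sum.map σ τ v) := by
    intro σ τ hσ hτ h1 h2
    exact ⟨hσ.sumMap hτ, by rintro (v | v) <;> simp [h1, h2]⟩
  obtain ⟨σ₀, hσ₀, hadj₀, -⟩ := hG a b hab
  obtain ⟨τ₀, hτ₀, hadj₀', -⟩ := hH p q hpq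
  rintro (a | a) (b | b) hab
  · obtain ⟨σ, hσ, hadj, ha, hb⟩ := hG a b (by simpa using hab)
    obtain ⟨h1, h2⟩ := key σ τ₀ hσ hτ₀ hadj hadj₀'
    exact ⟨_, h1, h2, by simpa using ha, by simpa using hb⟩
  · simp at hab
  · simp at hab
  · obtain ⟨τ, hτ, hadj, ha, hb⟩ := hH a b (by simpa using hab)
    obtain ⟨h1, h2⟩ := key σ₀ τ hσ₀ hτ hadj₀ hadj
    exact ⟨_, h1, h2, by simpa using ha, by simpa using hb⟩

open scoped Classical in
theorem two_mul_ncard_edgeSet {V : Type*} [Fintype V] (G : SimpleGraph V) :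
    2 * G.edgeSet.ncard = ∑ u, ∑ v, if G.Adj u v then 1 else 0 := by
  have h := G.sum_degrees_eq_twice_card_edges
  have h1 : G.edgeSet.ncard = G.edgeFinset.card := Set.ncard_eq_toFinset_card' _
  rw [h1, ← h]
  refine Finset.sum_congr rfl fun v _ => ?_
  rw [← Finset.card_filter, ← SimpleGraph.card_neighborFinset_eq_degree]
  congr 1
  ext u
  simp

theorem ncard_edgeSet_sum {V W : Type*} [Fintype V] [Fintype W] (G : SimpleGraph V)
    (H : SimpleGraph W) : (G ⊕g H).edgeSet.ncard = G.edgeSet.ncard + H.edgeSet.ncard := by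
  classical
  have h1 := two_mul_ncard_edgeSet G
  have h2 := two_mul_ncard_edgeSet H
  have h3 := two_mul_ncard_edgeSet (G ⊕g H)
  simp only [Fintype.sum_sum_type, SimpleGraph.sum_adj_inl, SimpleGraph.sum_adj_inr] at h3
  simp at h1 h2 h3
  omega

theorem ncard_edgeSet_fourWheel : fourWheel.edgeSet.ncard = 8 := by
  have h : ∑ u, ∑ v, (if fourWheel.Adj u v then 1 else 0) = 16 := by decide
  have h' := two_mul_ncard_edgeSet fourWheel
  have : 2 * fourWheel.edgeSet.ncard = 16 := by
    rw [h', ← h]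
    exact Finset.sum_congr rfl fun u _ => Finset.sum_congr rfl fun v _ => by congr
  omega

theorem ncard_edgeSet_evenCycle (k : ℕ) : (evenCycle k).edgeSet.ncard = 2 * (k + 2) := by
  classical
  have h := two_mul_ncard_edgeSet (evenCycle k)
  have h1 : ∀ p : ZMod (k + 2) × Bool, ∑ q, (if (evenCycle k).Adj p q then 1 else 0) = 2 := by
    intro p
    rw [← Finset.card_filter]
    refine Eq.trans ?_ (Finset.card_pair (rungMap_ne_stepMap p))
    congr 1
    ext q
    simp [evenCycle_adj]
  simp only [h1] at h
  simp [ZMod.card] at h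
  omega

theorem ncard_edgeSet_comap_equiv {V W : Type*} (G : SimpleGraph W) (e : V ≃ W) :
    (G.comap e).edgeSet.ncard = G.edgeSet.ncard :=
  Nat.card_congr (SimpleGraph.Iso.comap e G).mapEdgeSet

theorem exists_fmp_eq_two (k : ℕ) :
    ∃ G ∈ graphsWithFmp (2 * k + 9) 2, G.edgeSet.ncard = 2 * k + 9 + 3 := by
  have e : Fin (2 * k + 9) ≃ Fin 5 ⊕ (ZMod (k + 2) × Bool) := by
    refine Fintype.equivOfCardEq ?_
    simp [ZMod.card]
    omega
  refine ⟨(fourWheel ⊕g evenCycle k).comap e, ?_, ?_⟩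
  · have h := (hasAvoidingMaps_fourWheel.sum (hasAvoidingMaps_evenCycle (k := k))
      (a := 0) (b := 1) (by decide) (Or.inl rfl : (evenCycle k).Adj (0, true) _)).comap e
    refine h.fmp_eq_two (x := e.symm (Sum.inr (0, true)))
      (y := e.symm (Sum.inr (rungMap (0, true)))) (z := e.symm (Sum.inr (stepMap (0, true)))) ?_ ?_
    · intro h'
      exact rungMap_ne_stepMap _ (Sum.inr_injective (e.symm.injective h'))
    · intro v
      obtain ⟨w, rfl⟩ := e.symm.surjective v
      rw [SimpleGraph.comap_adj, e.apply_symm_apply, e.apply_symm_apply, e.symm.injective.eq_iff,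
        e.symm.injective.eq_iff]
      rcases w with w | w
      · simp
      · simp [evenCycle_adj]
  · rw [ncard_edgeSet_comap_equiv, ncard_edgeSet_sum, ncard_edgeSet_fourWheel,
      ncard_edgeSet_evenCycle]
    omega

end Construction

theorem theorem3p3 (n : ℕ) (hn : 9 ≤ n) (hodd : Odd n) :
    (graphsWithFmp n 2).Nonempty ∧ minEdges n 2 = n + 3 := by
  obtain ⟨k, rfl⟩ : ∃ k, n = 2 * k + 9 := by
    obtain ⟨m, rfl⟩ := hodd
    exact ⟨m - 4, by omega⟩
  obtain ⟨G, hG, hcard⟩ := exists_fmp_eq_two k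
  refine ⟨⟨G, hG⟩, le_antisymm (Nat.sInf_le ⟨G, hG, hcard⟩) ?_⟩
  refine le_csInf ⟨_, G, hG, hcard⟩ ?_
  rintro m ⟨H, hH, rfl⟩
  have h := (isRobust_of_two_le_fmp (le_of_eq (Eq.symm hH) : 2 ≤ fmp H)).card_add_three_le
    (by simpa using hodd)
  simpa using h
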